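/- Let $R$ be a unital associative ring. Let $\operatorname{silp} R$ denote the supremum of the injective dimensions of all projective left $R$-modules, and let $\operatorname{spli} R$ denote the supremum of the projective dimensions of all injective left $R$-modules (either supremum may be infinite). If $R$ is isomorphic, as a ring, to its opposite ring $R^{op}$, then $$\operatorname{silp} R \le \operatorname{spli} R,$$ and $\operatorname{silp} R = \operatorname{spli} R$ whenever $\operatorname{spli} R < \infty$. In particular, let $k$ be any commutative ring and $G$ any group. Then the group algebra $kG$ is isomorphic, as a ring, to its opposite ring; hence $\operatorname{silp} kG \le \operatorname{spli} kG$, and $\operatorname{silp} kG = \operatorname{spli} kG$ whenever $\operatorname{spli} kG < \infty$. -/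

import Mathlib

open CategoryTheory

universe u v

/-- `silp R`: the supremum of the injective dimensions of all projective (left) `R`-modules.
Injective dimensions take values in `WithBot ℕ∞`; only the zero module has dimension `⊥`, so that
the supremum is a natural number or `⊤` as soon as `R` is not the zero ring. -/
noncomputable def silp (R : Type u) [Ring R] : WithBot ℕ∞ :=
  ⨆ (P : ModuleCat.{u} R) (_ : Module.Projective R P), injectiveDimension P

/-- `spli R`: the supremum of the projective dimensions of all injective (left) `R`-modules,
with the same conventions as for `silp`. -/
noncomputable def spli (R : Type u) [Ring R] : WithBot ℕ∞ :=
  ⨆ (I : ModuleCat.{u} R) (_ : Module.Injective R I), projectiveDimension I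

/-! Suppose all injectives have projective dimension at most `n`. Embedding a module in an injective
and passing to `n`-th syzygies by the horseshoe lemma embeds any `n`-th syzygy in a free module with
cokernel again an `n`-th syzygy (`IsSyzygy.exists_embedding_free`). Iteration gives free
coresolutions, and dimension shifting along them gives Ext¹(L, Y) = 0 for `L` an `n`-th syzygy and
`Y` of finite injective dimension. The target of interest is instead a projective `P`.

The bridge is the character dual, a left module again through the isomorphism of `R` with its
opposite. It turns finite projective dimension into finite injective dimension, and finiteness of
`spli R` turns the latter back into finite projective dimension; so the double dual of a module of
finite projective dimension has both dimensions finite. Since a module is pure in its double dual,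
iterating on cokernels gives a pure exact coresolution of `P` by modules of finite injective
dimension. For 0 → K → F → L → 0 with `F` free and `L` an `n`-th syzygy, a map K → P extends to a
chain map from a free coresolution of `K` to this one. It is null-homotopic
(`IsPureExact.exists_nullHomotopy`), and the bottom component of the homotopy is an extension F → P.
Hence Ext¹(L, P) = 0, so Ext in degree `n + 1` into `P` vanishes.

The reverse inequality needs no symmetry: if projectives have injective dimension below `e`, the top
nonzero Ext of a module of finite projective dimension sits in degree below `e`. -/

/-- A sequence `Y 0 → Y 1 → ⋯` of modules is pure exact in positive degrees if maps from finitely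
presented modules `F ⧸ N` into the cycles of `Y (i + 1)` lift to `Y i`. -/
def IsPureExact {R : Type u} [Ring R] (Y : ℕ → Type u) [∀ i, AddCommGroup (Y i)]
    [∀ i, Module R (Y i)] (e : ∀ i, Y i →ₗ[R] Y (i + 1)) : Prop :=
  ∀ (i : ℕ) (F : Type u) [AddCommGroup F] [Module R F] [Module.Finite R F] [Module.Projective R F]
    (N : Submodule R F), N.FG → ∀ h : F →ₗ[R] Y (i + 1), (∀ x ∈ N, h x = 0) →
    (∀ x, e (i + 1) (h x) = 0) → ∃ t : F →ₗ[R] Y i, (∀ x ∈ N, t x = 0) ∧ ∀ x, e i (t x) = h x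

/-! ### Null-homotopies into pure exact complexes -/

section NullHomotopy

variable {R : Type u} [Ring R] {Y : ℕ → Type u} [∀ i, AddCommGroup (Y i)]
  [∀ i, Module R (Y i)] {e : ∀ i, Y i →ₗ[R] Y (i + 1)}

/-- With `N i` the boundaries in `P i`, the quotient `P i ⧸ N i` is finitely presented, so purity
applies to it. No induction on the degree is needed: `f` is first replaced by a map `g` vanishing on
boundaries, and two liftings then give the homotopy. -/
theorem IsPureExact.exists_nullHomotopy_of_finite (hY : IsPureExact Y e)
    (he : ∀ i x, e (i + 1) (e i x) = 0)
    {P : ℕ → Type u} [∀ i, AddCommGroup (P i)] [∀ i, Module R (P i)]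
    [∀ i, Module.Finite R (P i)] [∀ i, Module.Projective R (P i)]
    (d : ∀ i, P i →ₗ[R] P (i + 1)) (hd : ∀ i x, d (i + 1) (d i x) = 0)
    (f : ∀ i, P i →ₗ[R] Y (i + 1)) (hf : ∀ i x, f (i + 1) (d i x) = e (i + 1) (f i x)) :
    ∃ s : ∀ i, P i →ₗ[R] Y i, ∀ i x, f i x = e i (s i x) + s (i + 1) (d i x) := by
  obtain ⟨N, hN0, hN⟩ : ∃ N : ∀ i, Submodule R (P i), N 0 = ⊥ ∧
      ∀ i, N (i + 1) = LinearMap.range (d i) :=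
    ⟨fun i ↦ match i with
      | 0 => ⊥
      | i + 1 => LinearMap.range (d i), rfl, fun _ ↦ rfl⟩
  have hfg : ∀ i, (N i).FG := by
    rintro (_ | i)
    · rw [hN0]; exact Submodule.fg_bot
    · rw [hN, LinearMap.range_eq_map]; exact Module.Finite.fg_top.map _
  have hdN : ∀ i, ∀ x ∈ N i, d i x = 0 := by
    rintro (_ | i) x hx
    · rw [hN0, Submodule.mem_bot] at hx; simp [hx]
    · rw [hN] at hx
      obtain ⟨y, rfl⟩ := hx
      exact hd _ _
  have hdmem : ∀ i x, d i x ∈ N (i + 1) := fun i x ↦ by rw [hN]; exact ⟨x, rfl⟩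
  have h1 : ∀ i, ∃ g : P i →ₗ[R] Y (i + 1), (∀ x ∈ N i, g x = 0) ∧
      ∀ x, e (i + 1) (g x) = e (i + 1) (f i x) := fun i ↦
    hY (i + 1) (P i) (N i) (hfg i) (e (i + 1) ∘ₗ f i) (by
      intro x hx
      rw [LinearMap.comp_apply, ← hf, hdN i x hx, map_zero]) (fun x ↦ he _ _)
  choose g hgN hg using h1
  have h2 : ∀ i, ∃ s : P i →ₗ[R] Y i, ∀ x, e i (s x) = f i x - g i x := fun i ↦ by
    obtain ⟨s, -, hs⟩ := hY i (P i) ⊥ Submodule.fg_bot (f i - g i)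
      (by simp) (by simp [hg])
    exact ⟨s, by simpa using hs⟩
  choose s hs using h2
  -- The correction `t` must vanish on boundaries, so that adding it to `s` leaves the term `s (i +
  -- 1) ∘ d i` unchanged.
  have h3 : ∀ i, ∃ t : P i →ₗ[R] Y i, (∀ x ∈ N i, t x = 0) ∧
      ∀ x, e i (t x) = g i x - s (i + 1) (d i x) := fun i ↦ by
    obtain ⟨t, ht, ht'⟩ := hY i (P i) (N i) (hfg i) (g i - s (i + 1) ∘ₗ d i)
      (fun x hx ↦ by simp [hdN i x hx, hgN i x hx])
      (fun x ↦ by simp [hs, hg, hf, hgN _ _ (hdmem i x)])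
    exact ⟨t, ht, by simpa using ht'⟩
  choose t htN ht using h3
  refine ⟨fun i ↦ s i + t i, fun i x ↦ ?_⟩
  simp [hs, ht, htN _ _ (hdmem i x)]

variable (e) {B : ℕ → Type u} (d : ∀ i, (B i →₀ R) →ₗ[R] (B (i + 1) →₀ R))
  (f : ∀ i, (B i →₀ R) →ₗ[R] Y (i + 1))

/-- A null-homotopy of `f` on the subcomplex spanned by a `d`-closed set of basis elements. -/
structure PartialNullHomotopy where
  carrier : ∀ i, Set (B i)
  s : ∀ i, B i → Y i
  closed : ∀ i, ∀ b ∈ carrier i, ∀ c, d i (Finsupp.single b 1) c ≠ 0 → c ∈ carrier (i + 1)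
  eq : ∀ i, ∀ b ∈ carrier i, f i (Finsupp.single b 1) =
    e i (s i b) + Finsupp.linearCombination R (s (i + 1)) (d i (Finsupp.single b 1))

namespace PartialNullHomotopy

variable {e d f}

instance : Preorder (PartialNullHomotopy e d f) where
  le p q := ∀ i, ∀ b ∈ p.carrier i, b ∈ q.carrier i ∧ q.s i b = p.s i b
  le_refl p i b hb := ⟨hb, rfl⟩
  le_trans p q r hpq hqr i b hb :=
    ⟨(hqr i b (hpq i b hb).1).1, ((hqr i b (hpq i b hb).1).2).trans (hpq i b hb).2⟩

theorem bddAbove_of_isChain (c : Set (PartialNullHomotopy e d f)) (hc : IsChain (· ≤ ·) c) :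
    BddAbove c := by
  classical
  -- Members of a chain agree where both are defined, so any choice will do; the value 0 off the
  -- union is never used, by closedness.
  let s : ∀ i, B i → Y i := fun i b ↦
    if h : ∃ p ∈ c, b ∈ p.carrier i then h.choose.s i b else 0
  have hs : ∀ p ∈ c, ∀ i, ∀ b ∈ p.carrier i, s i b = p.s i b := by
    intro p hp i b hb
    have h : ∃ p ∈ c, b ∈ p.carrier i := ⟨p, hp, hb⟩
    have hq := h.choose_spec
    simp only [s, dif_pos h]
    rcases hc.total hp hq.1 with hle | hle
    · exact (hle i b hb).2
    · exact ((hle i b hq.2).2).symm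
  refine ⟨⟨fun i ↦ {b | ∃ p ∈ c, b ∈ p.carrier i}, s, ?_, ?_⟩, ?_⟩
  · rintro i b ⟨p, hp, hb⟩ c hc
    exact ⟨p, hp, p.closed i b hb c hc⟩
  · rintro i b ⟨p, hp, hb⟩
    rw [p.eq i b hb, hs p hp i b hb]
    congr 1
    simp only [Finsupp.linearCombination_apply]
    refine Finsupp.sum_congr fun x hx ↦ ?_
    rw [hs p hp _ _ (p.closed i b hb x (Finsupp.mem_support_iff.1 hx))]
  · exact fun p hp i b hb ↦ ⟨⟨p, hp, hb⟩, hs p hp i b hb⟩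

end PartialNullHomotopy

variable {e f}

/-- The differential raises the degree and each image has finite support, so closing up adds
finitely many basis elements in each degree. -/
theorem exists_finset_closed (i₀ : ℕ) (b₀ : B i₀) :
    ∃ T : ∀ i, Finset (B i), b₀ ∈ T i₀ ∧
      ∀ i, ∀ b ∈ T i, ∀ c, d i (Finsupp.single b 1) c ≠ 0 → c ∈ T (i + 1) := by
  classical
  let U : ∀ i, Finset (B i) := Function.update (fun _ ↦ ∅) i₀ {b₀}
  let T : ∀ i, Finset (B i) := fun i ↦ Nat.rec (U 0)
    (fun i Ti ↦ U (i + 1) ∪ Ti.biUnion fun b ↦ (d i (Finsupp.single b 1)).support) i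
  have hU : ∀ i, U i ⊆ T i := by
    rintro (_ | i)
    · exact subset_rfl
    · exact Finset.subset_union_left
  refine ⟨T, hU i₀ (by simp [U]), fun i b hb c hc ↦ ?_⟩
  exact Finset.mem_union_right _ (Finset.mem_biUnion.2 ⟨b, hb, Finsupp.mem_support_iff.2 hc⟩)

theorem Finsupp.map_mapDomain_subtypeDomain {B M : Type*} [AddCommGroup M] [Module R M]
    (L : (B →₀ R) →ₗ[R] M) (β : Set B) (x : B →₀ R)
    (h : ∀ b, x b ≠ 0 → b ∉ β → L (Finsupp.single b 1) = 0) :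
    L (Finsupp.lmapDomain R R (Subtype.val : β → B) (Finsupp.lsubtypeDomain (R := R) β x)) =
      L x := by
  have hL : ∀ y, L y = y.sum fun b r ↦ r • L (Finsupp.single b 1) := fun y ↦ by
    conv_lhs => rw [← Finsupp.sum_single y]
    rw [map_finsuppSum]
    refine Finsupp.sum_congr fun b _ ↦ ?_
    rw [← map_smul, Finsupp.smul_single, smul_eq_mul, mul_one]
  rw [← sub_eq_zero, ← map_sub, hL]
  refine Finset.sum_eq_zero fun b hb ↦ ?_
  by_cases hβ : b ∈ β
  · have : Finsupp.mapDomain (Subtype.val : β → B) (Finsupp.lsubtypeDomain (R := R) β x) b = x b :=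
      Finsupp.mapDomain_apply Subtype.val_injective _ (⟨b, hβ⟩ : β)
    simp [this]
  · by_cases hx : x b = 0
    · have : Finsupp.mapDomain (Subtype.val : β → B) (Finsupp.lsubtypeDomain (R := R) β x) b = 0 :=
        Finsupp.mapDomain_of_notMem_range _ _ (by simpa using hβ)
      simp [this, hx]
    · simp [h b hx hβ]

variable {d}

/-- The new basis elements `T i \ p.carrier i` span a degreewise finite free quotient complex. The
error of the given homotopy descends to it, and the finite case corrects the error. -/
theorem PartialNullHomotopy.exists_extension (hY : IsPureExact Y e)
    (he : ∀ i x, e (i + 1) (e i x) = 0) (hd : ∀ i x, d (i + 1) (d i x) = 0)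
    (hf : ∀ i x, f (i + 1) (d i x) = e (i + 1) (f i x))
    (p : PartialNullHomotopy e d f) (T : ∀ i, Finset (B i))
    (hT : ∀ i, ∀ b ∈ T i, ∀ c, d i (Finsupp.single b 1) c ≠ 0 → c ∈ T (i + 1)) :
    ∃ q : PartialNullHomotopy e d f, p ≤ q ∧ ∀ i, ∀ b ∈ T i, b ∈ q.carrier i := by
  let β : ∀ i, Set (B i) := fun i ↦ ↑(T i) \ p.carrier i
  have : ∀ i, Finite (β i) := fun i ↦ ((T i).finite_toSet.subset Set.sdiff_subset).to_subtype
  let incl : ∀ i, (β i →₀ R) →ₗ[R] (B i →₀ R) := fun i ↦ Finsupp.lmapDomain R R Subtype.val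
  let restr : ∀ i, (B i →₀ R) →ₗ[R] (β i →₀ R) := fun i ↦ Finsupp.lsubtypeDomain (β i)
  let d' : ∀ i, (β i →₀ R) →ₗ[R] (β (i + 1) →₀ R) := fun i ↦ restr (i + 1) ∘ₗ d i ∘ₗ incl i
  let lc : ∀ i, (B i →₀ R) →ₗ[R] Y i := fun i ↦ Finsupp.linearCombination R (p.s i)
  let f' : ∀ i, (B i →₀ R) →ₗ[R] Y (i + 1) := fun i ↦ f i - e i ∘ₗ lc i - lc (i + 1) ∘ₗ d i
  have hf'p : ∀ i, ∀ b ∈ p.carrier i, f' i (Finsupp.single b 1) = 0 := fun i b hb ↦ by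
    simp only [f', LinearMap.sub_apply, LinearMap.comp_apply, p.eq i b hb, lc,
      Finsupp.linearCombination_single, one_smul]
    abel
  have hf' : ∀ i x, f' (i + 1) (d i x) = e (i + 1) (f' i x) := fun i x ↦ by
    simp [f', hf, hd, he]
  have hrestr : ∀ i, ∀ b ∈ p.carrier i, restr i (Finsupp.single b 1) = 0 := fun i b hb ↦ by
    ext ⟨c, hc⟩
    have : b ≠ c := fun h ↦ hc.2 (h ▸ hb)
    exact Finsupp.single_eq_of_ne' this
  have hrestrd : ∀ i, ∀ b ∈ p.carrier i, restr (i + 1) (d i (Finsupp.single b 1)) = 0 :=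
    fun i b hb ↦ by
      ext ⟨c, hc⟩
      by_contra h
      exact hc.2 (p.closed i b hb c h)
  have hsupp : ∀ i (z : β i →₀ R) b, d i (incl i z) b ≠ 0 → b ∈ T (i + 1) := by
    intro i z b hb
    by_contra hbT
    have h0 : (Finsupp.lapply b : (B (i + 1) →₀ R) →ₗ[R] R) ∘ₗ d i ∘ₗ incl i = 0 := by
      refine Finsupp.lhom_ext' fun c ↦ LinearMap.ext_ring ?_
      by_contra h
      refine hbT (hT i c c.2.1 b ?_)
      simpa [incl] using h
    exact hb (DFunLike.congr_fun h0 z)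
  -- Projecting to the new basis elements can be undone in front of any map that vanishes on the old
  -- ones; this gives the complex and chain map identities on the quotient.
  have key : ∀ i (z : β i →₀ R) (M : Type u) [AddCommGroup M] [Module R M]
      (l : (B (i + 1) →₀ R) →ₗ[R] M),
      (∀ b ∈ p.carrier (i + 1), l (Finsupp.single b 1) = 0) →
      l (incl (i + 1) (d' i z)) = l (d i (incl i z)) := by
    intro i z M _ _ l hl
    refine Finsupp.map_mapDomain_subtypeDomain l (β (i + 1)) _ fun b hb hbβ ↦ hl b ?_
    by_contra h
    exact hbβ ⟨hsupp i z b hb, h⟩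
  obtain ⟨t, ht⟩ := hY.exists_nullHomotopy_of_finite he d'
    (fun i z ↦ (key i z _ (restr (i + 1 + 1) ∘ₗ d (i + 1)) (hrestrd (i + 1))).trans
      (by simp [hd]))
    (fun i ↦ f' i ∘ₗ incl i)
    (fun i z ↦ (key i z _ (f' (i + 1)) (hf'p (i + 1))).trans (hf' _ _))
  have hlc : ∀ i x, Finsupp.linearCombination R
      (fun b ↦ p.s i b + t i (restr i (Finsupp.single b 1))) x = lc i x + t i (restr i x) := by
    intro i x
    refine DFunLike.congr_fun (f := Finsupp.linearCombination R
      (fun b ↦ p.s i b + t i (restr i (Finsupp.single b 1)))) (g := lc i + t i ∘ₗ restr i) ?_ x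
    refine Finsupp.lhom_ext' fun c ↦ LinearMap.ext_ring ?_
    simp [lc]
  refine ⟨⟨fun i ↦ p.carrier i ∪ T i, fun i b ↦ p.s i b + t i (restr i (Finsupp.single b 1)),
    ?_, ?_⟩, fun i b hb ↦ ⟨Or.inl hb, by simp [hrestr i b hb]⟩, fun i b hb ↦ Or.inr hb⟩
  · rintro i b (hb | hb) c hc
    · exact Or.inl (p.closed i b hb c hc)
    · exact Or.inr (hT i b hb c hc)
  · intro i b hb
    rw [hlc]
    by_cases hbp : b ∈ p.carrier i
    · simp [hrestr i b hbp, hrestrd i b hbp, p.eq i b hbp, lc]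
    · have hbT : b ∈ T i := hb.resolve_left hbp
      have h1 : incl i (restr i (Finsupp.single b 1)) = Finsupp.single b 1 :=
        Finsupp.map_mapDomain_subtypeDomain (R := R) LinearMap.id (β i) (Finsupp.single b 1)
          fun c hc hcβ ↦ by
          obtain rfl : b = c := by
            by_contra h
            exact hc (Finsupp.single_eq_of_ne' h)
          exact absurd ⟨hbT, hbp⟩ hcβ
      have h2 := ht i (restr i (Finsupp.single b 1))
      simp only [d', LinearMap.comp_apply, h1] at h2
      simp only [f', LinearMap.sub_apply, LinearMap.comp_apply, lc,
        Finsupp.linearCombination_single, one_smul] at h2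
      rw [map_add, ← sub_eq_zero]
      rw [← sub_eq_zero] at h2
      rw [← h2]
      abel

/-- Maps from a complex of free modules to a pure exact complex are null-homotopic. -/
theorem IsPureExact.exists_nullHomotopy (hY : IsPureExact Y e)
    (he : ∀ i x, e (i + 1) (e i x) = 0) (hd : ∀ i x, d (i + 1) (d i x) = 0)
    (hf : ∀ i x, f (i + 1) (d i x) = e (i + 1) (f i x)) :
    ∃ s : ∀ i, (B i →₀ R) →ₗ[R] Y i, ∀ i x, f i x = e i (s i x) + s (i + 1) (d i x) := by
  -- By the extension step, a maximal partial homotopy contains every basis element.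
  obtain ⟨p, hp⟩ := zorn_le (PartialNullHomotopy.bddAbove_of_isChain (e := e) (d := d) (f := f))
  have hmem : ∀ i (b : B i), b ∈ p.carrier i := fun i b ↦ by
    obtain ⟨T, hbT, hT⟩ := exists_finset_closed d i b
    obtain ⟨q, hpq, hq⟩ := p.exists_extension hY he hd hf T hT
    exact (hp hpq i b (hq i b hbT)).1
  refine ⟨fun i ↦ Finsupp.linearCombination R (p.s i), fun i x ↦ ?_⟩
  refine DFunLike.congr_fun (f := f i) (g := e i ∘ₗ Finsupp.linearCombination R (p.s i) +
    Finsupp.linearCombination R (p.s (i + 1)) ∘ₗ d i) ?_ x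
  refine Finsupp.lhom_ext' fun c ↦ LinearMap.ext_ring ?_
  simpa using p.eq i c (hmem i c)

end NullHomotopy

/-! ### Character duals and purity of the double dual -/

section TwistedDual

variable {R : Type u} [Ring R]

/-- The character module of a left module, as a left module through a ring homomorphism from
the ring to its opposite. -/
@[nolint unusedArguments]
def TwistedDual (_τ : R →+* Rᵐᵒᵖ) (M : Type u) [AddCommGroup M] : Type u :=
  CharacterModule M

namespace TwistedDual

variable (τ τ' : R →+* Rᵐᵒᵖ) (M : Type u) [AddCommGroup M]

instance : AddCommGroup (TwistedDual τ M) := inferInstanceAs (AddCommGroup (CharacterModule M))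

instance : FunLike (TwistedDual τ M) M (AddCircle (1 : ℚ)) :=
  inferInstanceAs (FunLike (CharacterModule M) M (AddCircle (1 : ℚ)))

instance : AddMonoidHomClass (TwistedDual τ M) M (AddCircle (1 : ℚ)) where
  map_add (φ : M →+ AddCircle (1 : ℚ)) := φ.map_add
  map_zero (φ : M →+ AddCircle (1 : ℚ)) := φ.map_zero

variable {τ M} in
@[ext] theorem ext {φ ψ : TwistedDual τ M} (h : ∀ x, φ x = ψ x) : φ = ψ := DFunLike.ext _ _ h

@[simp] theorem add_apply (φ ψ : TwistedDual τ M) (x : M) : (φ + ψ) x = φ x + ψ x := rfl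

@[simp] theorem zero_apply (x : M) : (0 : TwistedDual τ M) x = 0 := rfl

/-- Evaluation at an element. -/
def eval (x : M) : TwistedDual τ M →+ AddCircle (1 : ℚ) where
  toFun φ := φ x
  map_zero' := rfl
  map_add' _ _ := rfl

variable [Module R M]

instance : SMul R (TwistedDual τ M) where
  smul r φ := AddMonoidHom.comp (φ : M →+ AddCircle (1 : ℚ))
    (DistribSMul.toAddMonoidHom M (τ r).unop)

@[simp] theorem smul_apply (r : R) (φ : TwistedDual τ M) (x : M) :
    (r • φ) x = φ ((τ r).unop • x) := rfl

instance : Module R (TwistedDual τ M) where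
  one_smul φ := by ext; simp
  mul_smul r s φ := by ext; simp [mul_smul]
  smul_zero r := by ext; simp
  smul_add r φ ψ := by ext; simp
  add_smul r s φ := by ext; simp [add_smul]
  zero_smul φ := by ext; simp

variable {M} {N L : Type u} [AddCommGroup N] [Module R N] [AddCommGroup L] [Module R L]

/-- Precomposition with a linear map. -/
def map (f : M →ₗ[R] N) : TwistedDual τ N →ₗ[R] TwistedDual τ M where
  toFun φ := AddMonoidHom.comp (φ : N →+ AddCircle (1 : ℚ)) f.toAddMonoidHom
  map_add' _ _ := rfl
  map_smul' r φ := by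
    ext x
    exact congrArg φ (f.map_smul _ x).symm

@[simp] theorem map_apply (f : M →ₗ[R] N) (φ : TwistedDual τ N) (x : M) :
    map τ f φ x = φ (f x) := rfl

theorem map_surjective {f : M →ₗ[R] N} (hf : Function.Injective f) :
    Function.Surjective (map τ f) :=
  CharacterModule.dual_surjective_of_injective f.toAddMonoidHom.toIntLinearMap hf

theorem map_injective {f : M →ₗ[R] N} (hf : Function.Surjective f) :
    Function.Injective (map τ f) := by
  intro φ ψ h
  ext x
  obtain ⟨y, rfl⟩ := hf x
  exact DFunLike.congr_fun h y

theorem map_exact {f : M →ₗ[R] N} {g : N →ₗ[R] L} (h : Function.Exact f g)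
    (hg : Function.Surjective g) : Function.Exact (map τ g) (map τ f) := by
  intro φ
  constructor
  · intro hφ
    refine ⟨(g.toAddMonoidHom.liftOfSurjective hg ⟨(φ : N →+ AddCircle (1 : ℚ)), ?_⟩ :
      L →+ AddCircle (1 : ℚ)), ?_⟩
    · intro x hx
      obtain ⟨y, rfl⟩ := (h x).1 hx
      exact DFunLike.congr_fun hφ y
    · ext x
      exact DFunLike.congr_fun (AddMonoidHom.liftOfRightInverse_comp g.toAddMonoidHom _
        (Function.rightInverse_surjInv hg) ⟨(φ : N →+ AddCircle (1 : ℚ)), _⟩) x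
  · rintro ⟨ψ, rfl⟩
    ext x
    simp [h.apply_apply_eq_zero]

variable {τ τ'} (hτ : ∀ r, (τ (τ' r).unop).unop = r)

/-- Interchange of the arguments of a bilinear pairing. -/
def flip (g : M →ₗ[R] TwistedDual τ N) : N →ₗ[R] TwistedDual τ' M where
  toFun x := (eval τ N x).comp g.toAddMonoidHom
  map_add' x y := by
    ext m
    exact map_add (g m) x y
  map_smul' r x := by
    ext m
    change g m (r • x) = g ((τ' r).unop • m) x
    rw [g.map_smul, smul_apply, hτ]

@[simp] theorem flip_apply (g : M →ₗ[R] TwistedDual τ N) (x : N) (m : M) :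
    flip hτ g x m = g m x := rfl

/-- The canonical map to the double dual. -/
def unit (M : Type u) [AddCommGroup M] [Module R M] :
    M →ₗ[R] TwistedDual τ' (TwistedDual τ M) :=
  flip hτ LinearMap.id

@[simp] theorem unit_apply (x : M) (φ : TwistedDual τ M) : unit hτ M x φ = φ x := rfl

theorem unit_injective : Function.Injective (unit hτ M) := by
  rw [injective_iff_map_eq_zero]
  intro x hx
  exact CharacterModule.eq_zero_of_character_apply fun c ↦ DFunLike.congr_fun hx c

-- By flipping arguments, extending a map A → M* along A → B amounts to lifting M → A* along the
-- surjection B* → A*.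
include hτ in
theorem injective_of_projective (hτ' : ∀ r, (τ' (τ r).unop).unop = r) [Module.Projective R M] :
    Module.Injective R (TwistedDual τ M) where
  out A B _ _ _ _ f hf g := by
    obtain ⟨k, hk⟩ := Module.projective_lifting_property (map τ' f) (flip hτ g)
      (map_surjective τ' hf)
    refine ⟨flip hτ' k, fun a ↦ ?_⟩
    ext x
    exact DFunLike.congr_fun (DFunLike.congr_fun hk x) a

/-- Generators of `N` give a finite linear system with constants in `M` that `h` solves in the
double dual. If it had no solution in `M`, some character would vanish on all attainable right-hand
sides but not on the given one. -/
theorem exists_eq_unit_of_free {n : ℕ} (N : Submodule R (Fin n → R)) (hN : N.FG)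
    (h : (Fin n → R) →ₗ[R] TwistedDual τ' (TwistedDual τ M))
    (hh : ∀ x ∈ N, h x ∈ LinearMap.range (unit hτ M)) :
    ∃ k : (Fin n → R) →ₗ[R] M, ∀ x ∈ N, unit hτ M (k x) = h x := by
  classical
  obtain ⟨S, rfl⟩ := hN
  have hS : ∀ b : S, ∃ c : M, unit hτ M c = h b := fun b ↦ hh _ (Submodule.subset_span b.2)
  choose c hc using hS
  let y : Fin n → TwistedDual τ' (TwistedDual τ M) := fun j ↦ h (Pi.single j 1)
  have hy : ∀ x, h x = ∑ j, x j • y j := fun x ↦ by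
    conv_lhs => rw [LinearMap.pi_apply_eq_sum_univ h x]
    refine Finset.sum_congr rfl fun j _ ↦ ?_
    simp only [y]
    congr 2
    ext i
    simp [Pi.single_apply, eq_comm]
  let ev : (Fin n → M) →+ (S → M) :=
    { toFun := fun m b ↦ ∑ j, (b : Fin n → R) j • m j
      map_zero' := by ext; simp
      map_add' := fun m m' ↦ by ext; simp [Finset.sum_add_distrib] }
  suffices hcr : c ∈ ev.range by
    obtain ⟨m, hm⟩ := hcr
    let k : (Fin n → R) →ₗ[R] M := ∑ j, (LinearMap.proj j).smulRight (m j)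
    have hk : ∀ b : S, k b = c b := fun b ↦ by
      rw [← hm]
      simp [k, ev]
    refine ⟨k, fun x hx ↦ ?_⟩
    have : Set.EqOn (unit hτ M ∘ₗ k) h (Submodule.span R (S : Set (Fin n → R))) :=
      LinearMap.eqOn_span fun b hb ↦ by
        rw [LinearMap.comp_apply, hk ⟨b, hb⟩, hc]
    exact this hx
  rw [← QuotientAddGroup.eq_zero_iff]
  refine CharacterModule.eq_zero_of_character_apply fun χ' ↦ ?_
  let χ : (S → M) →+ AddCircle (1 : ℚ) :=
    AddMonoidHom.comp (χ' : _ →+ AddCircle (1 : ℚ)) (QuotientAddGroup.mk' ev.range)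
  have hχ : ∀ m, χ (ev m) = 0 := fun m ↦ by
    have : (QuotientAddGroup.mk' ev.range) (ev m) = 0 :=
      (QuotientAddGroup.eq_zero_iff _).2 ⟨m, rfl⟩
    exact (congrArg χ' this).trans (map_zero χ')
  change χ c = 0
  let χc : S → TwistedDual τ M := fun b ↦ χ.comp (AddMonoidHom.single (fun _ ↦ M) b)
  have hχc : ∀ m : S → M, χ m = ∑ b, χc b (m b) := fun m ↦ by
    conv_lhs => rw [← Finset.univ_sum_single m]
    rw [map_sum]
    rfl
  -- Vanishing of `χ` on the image of `ev` is a set of relations in the dual; the solution `y` in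
  -- the double dual, evaluated on them, gives `χ c = 0`.
  have h0 : ∀ j, ∑ b : S, (τ' ((b : Fin n → R) j)).unop • χc b = 0 := fun j ↦ by
    ext x
    have h1 := hχ (Pi.single j x)
    rw [hχc] at h1
    rw [zero_apply, ← h1]
    change eval τ M x _ = _
    rw [map_sum]
    refine Finset.sum_congr rfl fun b _ ↦ ?_
    change χc b ((τ (τ' ((b : Fin n → R) j)).unop).unop • x) = _
    rw [hτ]
    congr 1
    simp [ev, Pi.single_apply]
  have h2 : ∀ b : S, χc b (c b) = ∑ j, y j ((τ' ((b : Fin n → R) j)).unop • χc b) := fun b ↦ by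
    rw [← unit_apply hτ, hc, hy]
    change eval τ' _ (χc b) _ = _
    rw [map_sum]
    rfl
  rw [hχc, Finset.sum_congr rfl fun b _ ↦ h2 b, Finset.sum_comm]
  refine Finset.sum_eq_zero fun j _ ↦ ?_
  rw [← map_sum, h0, map_zero]

theorem exists_eq_unit {F : Type u} [AddCommGroup F] [Module R F] [Module.Finite R F]
    [Module.Projective R F] (N : Submodule R F) (hN : N.FG)
    (h : F →ₗ[R] TwistedDual τ' (TwistedDual τ M))
    (hh : ∀ x ∈ N, h x ∈ LinearMap.range (unit hτ M)) :
    ∃ k : F →ₗ[R] M, ∀ x ∈ N, unit hτ M (k x) = h x := by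
  obtain ⟨n, π, hπ⟩ := Module.Finite.exists_fin' R F
  obtain ⟨s, hs⟩ := Module.projective_lifting_property π LinearMap.id hπ
  have hs' : ∀ x, π (s x) = x := DFunLike.congr_fun hs
  obtain ⟨k, hk⟩ := exists_eq_unit_of_free hτ (N.map s) (hN.map s) (h ∘ₗ π) (by
    rintro _ ⟨x, hx, rfl⟩
    simpa [hs'] using hh x hx)
  refine ⟨k ∘ₗ s, fun x hx ↦ ?_⟩
  simpa [hs'] using hk (s x) ⟨x, hx, rfl⟩

/-- The canonical map to the double dual is a pure monomorphism. -/
theorem exists_lift_mkQ_range_unit {F : Type u} [AddCommGroup F] [Module R F]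
    [Module.Finite R F] [Module.Projective R F] (N : Submodule R F) (hN : N.FG)
    (h : F →ₗ[R] (TwistedDual τ' (TwistedDual τ M) ⧸ LinearMap.range (unit hτ M)))
    (hh : ∀ x ∈ N, h x = 0) :
    ∃ t : F →ₗ[R] TwistedDual τ' (TwistedDual τ M), (∀ x ∈ N, t x = 0) ∧
      ∀ x, (LinearMap.range (unit hτ M)).mkQ (t x) = h x := by
  obtain ⟨h', hh'⟩ := Module.projective_lifting_property (LinearMap.range (unit hτ M)).mkQ h
    (Submodule.mkQ_surjective _)
  have hh'' : ∀ x, (LinearMap.range (unit hτ M)).mkQ (h' x) = h x := DFunLike.congr_fun hh'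
  obtain ⟨k, hk⟩ := exists_eq_unit hτ N hN h' (fun x hx ↦ by
    rw [← Submodule.Quotient.mk_eq_zero, ← hh x hx, ← hh'']; rfl)
  -- Subtracting a map with values in `M` kills `N` without changing the class modulo `M`.
  refine ⟨h' - unit hτ M ∘ₗ k, fun x hx ↦ by simp [hk x hx], fun x ↦ ?_⟩
  rw [LinearMap.sub_apply, map_sub, hh'', LinearMap.comp_apply, sub_eq_self]
  exact (Submodule.Quotient.mk_eq_zero _).2 ⟨_, rfl⟩

end TwistedDual

end TwistedDual

/-! ### The coresolution by double duals -/

namespace DoubleDual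

variable {R : Type u} [Ring R] {τ τ' : R →+* Rᵐᵒᵖ} (hτ : ∀ r, (τ (τ' r).unop).unop = r)

/-- The cosyzygies of a module with respect to the embeddings into double duals. -/
def cosyzygy (X : ModuleCat.{u} R) : ℕ → ModuleCat.{u} R
  | 0 => X
  | i + 1 => ModuleCat.of R (TwistedDual τ' (TwistedDual τ (cosyzygy X i)) ⧸
      LinearMap.range (TwistedDual.unit hτ (cosyzygy X i)))

/-- The terms of the coresolution of a module by double duals, starting with the module. -/
def term (X : ModuleCat.{u} R) : ℕ → ModuleCat.{u} R
  | 0 => X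
  | i + 1 => ModuleCat.of R (TwistedDual τ' (TwistedDual τ (cosyzygy hτ X i)))

/-- The projection from a term of the coresolution to the cosyzygy. -/
def proj (X : ModuleCat.{u} R) : ∀ i, term hτ X i →ₗ[R] cosyzygy hτ X i
  | 0 => LinearMap.id
  | i + 1 => (LinearMap.range (TwistedDual.unit hτ (cosyzygy hτ X i))).mkQ

/-- The inclusion of a cosyzygy into the next term of the coresolution. -/
def incl (X : ModuleCat.{u} R) (i : ℕ) : cosyzygy hτ X i →ₗ[R] term hτ X (i + 1) :=
  TwistedDual.unit hτ (cosyzygy hτ X i)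

variable (X : ModuleCat.{u} R)

theorem incl_injective (i : ℕ) : Function.Injective (incl hτ X i) := TwistedDual.unit_injective hτ

theorem exact_incl_proj (i : ℕ) : Function.Exact (incl hτ X i) (proj hτ X (i + 1)) :=
  fun _ ↦ Submodule.Quotient.mk_eq_zero _

theorem proj_surjective (i : ℕ) : Function.Surjective (proj hτ X i) := by
  cases i with
  | zero => exact Function.surjective_id
  | succ i => exact Submodule.mkQ_surjective _

theorem isPureExact : IsPureExact (fun i ↦ term hτ X i) (fun i ↦ incl hτ X i ∘ₗ proj hτ X i) := by
  intro i F _ _ _ _ N hN h hhN hh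
  have hp : ∀ x, proj hτ X (i + 1) (h x) = 0 := fun x ↦
    incl_injective hτ X (i + 1) ((hh x).trans (map_zero _).symm)
  have hr : ∀ x, h x ∈ LinearMap.range (incl hτ X i) := fun x ↦
    (exact_incl_proj hτ X i _).1 (hp x)
  let h' : F →ₗ[R] cosyzygy hτ X i :=
    (LinearEquiv.ofInjective _ (incl_injective hτ X i)).symm ∘ₗ h.codRestrict _ hr
  have hh' : ∀ x, incl hτ X i (h' x) = h x := fun x ↦
    congrArg Subtype.val ((LinearEquiv.ofInjective _ (incl_injective hτ X i)).apply_symm_apply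
      (h.codRestrict _ hr x))
  have hN' : ∀ x ∈ N, h' x = 0 := fun x hx ↦ incl_injective hτ X i <| by
    rw [hh', hhN x hx, map_zero]
  -- In degree zero the projection is the identity; above it, this is purity of the module in its
  -- double dual.
  obtain ⟨t, ht, ht'⟩ : ∃ t : F →ₗ[R] term hτ X i, (∀ x ∈ N, t x = 0) ∧
      ∀ x, proj hτ X i (t x) = h' x := by
    cases i with
    | zero => exact ⟨h', hN', fun x ↦ rfl⟩
    | succ i => exact TwistedDual.exists_lift_mkQ_range_unit hτ N hN h' hN'
  exact ⟨t, ht, fun x ↦ by rw [LinearMap.comp_apply, ht', hh']⟩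

end DoubleDual

/-! ### Dimension shifting and dimensions of duals -/

section ShortExact

variable {R : Type u} [Ring R]

/-- The sequence `0 → A → B → C → 0` is exact. -/
structure IsShortExact {A B C : Type u} [AddCommGroup A] [Module R A] [AddCommGroup B] [Module R B]
    [AddCommGroup C] [Module R C] (i : A →ₗ[R] B) (p : B →ₗ[R] C) : Prop where
  injective : Function.Injective i
  exact : Function.Exact i p
  surjective : Function.Surjective p

namespace IsShortExact

section

variable {A B C : Type u} [AddCommGroup A] [Module R A] [AddCommGroup B] [Module R B]
    [AddCommGroup C] [Module R C] {i : A →ₗ[R] B} {p : B →ₗ[R] C}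

theorem shortExact (h : IsShortExact i p) :
    (ModuleCat.shortComplexOfCompEqZero i p h.exact.linearMap_comp_eq_zero).ShortExact :=
  ModuleCat.shortComplex_shortExact _ h.exact h.injective h.surjective

theorem ker_subtype (hp : Function.Surjective p) :
    IsShortExact (LinearMap.ker p).subtype p :=
  ⟨Submodule.subtype_injective _, LinearMap.exact_subtype_ker_map p, hp⟩

theorem mkQ_range (hi : Function.Injective i) :
    IsShortExact i (LinearMap.range i).mkQ :=
  ⟨hi, LinearMap.exact_map_mkQ_range i, Submodule.mkQ_surjective _⟩

theorem exists_lift (h : IsShortExact i p) {D : Type u} [AddCommGroup D] [Module R D]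
    (f : D →ₗ[R] B) (hf : ∀ x, p (f x) = 0) : ∃ g : D →ₗ[R] A, ∀ x, i (g x) = f x := by
  have hr : ∀ x, f x ∈ LinearMap.range i := fun x ↦ (h.exact _).1 (hf x)
  exact ⟨(LinearEquiv.ofInjective i h.injective).symm ∘ₗ f.codRestrict _ hr,
    fun x ↦ congrArg Subtype.val ((LinearEquiv.ofInjective i h.injective).apply_symm_apply
      (f.codRestrict _ hr x))⟩

theorem exists_desc (h : IsShortExact i p) {D : Type u} [AddCommGroup D] [Module R D]
    (f : B →ₗ[R] D) (hf : ∀ x, f (i x) = 0) : ∃ g : C →ₗ[R] D, ∀ x, g (p x) = f x := by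
  have hker : LinearMap.ker p ≤ LinearMap.ker f := fun x hx ↦ by
    obtain ⟨y, rfl⟩ := (h.exact x).1 hx
    exact hf y
  refine ⟨(LinearMap.ker p).liftQ f hker ∘ₗ
    (p.quotKerEquivOfSurjective h.surjective).symm, fun x ↦ ?_⟩
  have : (p.quotKerEquivOfSurjective h.surjective).symm (p x) = Submodule.Quotient.mk x := by
    rw [LinearEquiv.symm_apply_eq]; rfl
  simp [this]

end

theorem exists_free (M : ModuleCat.{u} R) :
    ∃ (K : ModuleCat.{u} R) (i : K →ₗ[R] (M →₀ R)) (p : (M →₀ R) →ₗ[R] M),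
      IsShortExact i p :=
  ⟨ModuleCat.of R (LinearMap.ker (Finsupp.linearCombination R (id : M → M))), _, _,
    ker_subtype (Finsupp.linearCombination_id_surjective R M)⟩

theorem exists_injective (M : ModuleCat.{u} R) :
    ∃ (I C : ModuleCat.{u} R) (i : M →ₗ[R] I) (p : I →ₗ[R] C),
      Module.Injective R I ∧ IsShortExact i p := by
  obtain ⟨J⟩ := EnoughInjectives.presentation M
  have hi : Function.Injective J.f.hom := (ModuleCat.mono_iff_injective _).1 J.mono
  exact ⟨J.J, ModuleCat.of R (J.J ⧸ LinearMap.range J.f.hom), J.f.hom, _,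
    (Module.injective_iff_injective_object R J.J).2 J.injective, mkQ_range hi⟩

variable {A B C : ModuleCat.{u} R} {i : A →ₗ[R] B} {p : B →ₗ[R] C}

theorem hasProjectiveDimensionLT_left (h : IsShortExact i p) {n : ℕ}
    (hB : HasProjectiveDimensionLT B n) (hC : HasProjectiveDimensionLT C (n + 1)) :
    HasProjectiveDimensionLT A n :=
  h.shortExact.hasProjectiveDimensionLT_X₁ n hB hC

theorem hasProjectiveDimensionLT_right (h : IsShortExact i p) {n : ℕ}
    (hA : HasProjectiveDimensionLT A n) (hB : HasProjectiveDimensionLT B (n + 1)) :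
    HasProjectiveDimensionLT C (n + 1) :=
  h.shortExact.hasProjectiveDimensionLT_X₃ n hA hB

theorem hasInjectiveDimensionLT_left (h : IsShortExact i p) {n : ℕ}
    (hC : HasInjectiveDimensionLT C n) (hB : HasInjectiveDimensionLT B (n + 1)) :
    HasInjectiveDimensionLT A (n + 1) :=
  h.shortExact.hasInjectiveDimensionLT_X₁ n hC hB

theorem hasInjectiveDimensionLT_right (h : IsShortExact i p) {n : ℕ}
    (hB : HasInjectiveDimensionLT B n) (hA : HasInjectiveDimensionLT A (n + 1)) :
    HasInjectiveDimensionLT C n :=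
  h.shortExact.hasInjectiveDimensionLT_X₃ n hB hA

end IsShortExact

theorem hasProjectiveDimensionLT_succ_of_projective (P : ModuleCat.{u} R) [Module.Projective R P]
    (n : ℕ) : HasProjectiveDimensionLT P (n + 1) :=
  have : Projective P := (IsProjective.iff_projective (P : Type u)).1 inferInstance
  hasProjectiveDimensionLT_of_ge P 1 _ (by lia)

theorem hasInjectiveDimensionLT_succ_of_injective (I : ModuleCat.{u} R) [hI : Module.Injective R I]
    (n : ℕ) : HasInjectiveDimensionLT I (n + 1) :=
  have : Injective I := (Module.injective_iff_injective_object R I).1 hI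
  have := injective_iff_hasInjectiveDimensionLT_one.1 this
  hasInjectiveDimensionLT_of_ge I 1 _ (by lia)

theorem projective_of_hasProjectiveDimensionLT_one (P : ModuleCat.{u} R)
    (h : HasProjectiveDimensionLT P 1) : Module.Projective R P :=
  (IsProjective.iff_projective (P : Type u)).2 (projective_iff_hasProjectiveDimensionLT_one.2 h)

theorem injective_of_hasInjectiveDimensionLT_one (I : ModuleCat.{u} R)
    (h : HasInjectiveDimensionLT I 1) : Module.Injective R I :=
  (Module.injective_iff_injective_object R I).2 (injective_iff_hasInjectiveDimensionLT_one.2 h)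

theorem exists_hasProjectiveDimensionLT {d : ℕ}
    (hd : ∀ I : ModuleCat.{u} R, Module.Injective R I → HasProjectiveDimensionLT I d) (m : ℕ)
    (M : ModuleCat.{u} R) (hM : HasInjectiveDimensionLT M (m + 1)) :
    ∃ k, HasProjectiveDimensionLT M (k + 1) := by
  induction m generalizing M with
  | zero =>
    have := hd M (injective_of_hasInjectiveDimensionLT_one M hM)
    exact ⟨d, hasProjectiveDimensionLT_of_ge M d _ (by lia)⟩
  | succ m ih =>
    obtain ⟨I, C, i, p, hI, h⟩ := IsShortExact.exists_injective M
    obtain ⟨k, hk⟩ := ih C (h.hasInjectiveDimensionLT_right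
      (hasInjectiveDimensionLT_succ_of_injective I m) hM)
    have hI' := hd I hI
    exact ⟨d + k, h.hasProjectiveDimensionLT_left
      (hasProjectiveDimensionLT_of_ge I d _ (by lia))
      (hasProjectiveDimensionLT_of_ge C (k + 1) _ (by lia))⟩

variable {τ τ' : R →+* Rᵐᵒᵖ}

/-- A free presentation dualises to an embedding in an injective, whose cokernel is the dual of the
syzygy. -/
theorem TwistedDual.hasInjectiveDimensionLT (hτ : ∀ r, (τ (τ' r).unop).unop = r)
    (hτ' : ∀ r, (τ' (τ r).unop).unop = r) (m : ℕ) (M : ModuleCat.{u} R)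
    (hM : HasProjectiveDimensionLT M (m + 1)) :
    HasInjectiveDimensionLT (ModuleCat.of R (TwistedDual τ M)) (m + 1) := by
  induction m generalizing M with
  | zero =>
    have := projective_of_hasProjectiveDimensionLT_one M hM
    have : Module.Injective R (ModuleCat.of R (TwistedDual τ M)) :=
      TwistedDual.injective_of_projective hτ hτ'
    exact hasInjectiveDimensionLT_succ_of_injective _ 0
  | succ m ih =>
    obtain ⟨K, i, p, h⟩ := IsShortExact.exists_free M
    have hK := ih K (h.hasProjectiveDimensionLT_left (B := ModuleCat.of R (M →₀ R))
      (hasProjectiveDimensionLT_succ_of_projective _ m) hM)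
    have hF : Module.Injective R (ModuleCat.of R (TwistedDual τ (M →₀ R))) :=
      TwistedDual.injective_of_projective hτ hτ'
    have hD : IsShortExact (TwistedDual.map τ p) (TwistedDual.map τ i) :=
      ⟨TwistedDual.map_injective τ h.surjective, TwistedDual.map_exact τ h.exact h.surjective,
        TwistedDual.map_surjective τ h.injective⟩
    exact hD.hasInjectiveDimensionLT_left (A := ModuleCat.of R (TwistedDual τ M))
      (B := ModuleCat.of R (TwistedDual τ (M →₀ R))) (C := ModuleCat.of R (TwistedDual τ K)) hK
      (hasInjectiveDimensionLT_succ_of_injective _ _)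

/-- Each dualisation gives finite injective dimension, which the bound on injectives converts to
finite projective dimension. -/
theorem DoubleDual.exists_dimensionLT {d : ℕ}
    (hd : ∀ I : ModuleCat.{u} R, Module.Injective R I → HasProjectiveDimensionLT I d)
    (hτ : ∀ r, (τ (τ' r).unop).unop = r) (hτ' : ∀ r, (τ' (τ r).unop).unop = r)
    {k : ℕ} (M : ModuleCat.{u} R) (hM : HasProjectiveDimensionLT M (k + 1)) :
    ∃ m, HasProjectiveDimensionLT (ModuleCat.of R (TwistedDual τ' (TwistedDual τ M))) (m + 1) ∧
      HasInjectiveDimensionLT (ModuleCat.of R (TwistedDual τ' (TwistedDual τ M))) (m + 1) := by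
  obtain ⟨l, hl⟩ := exists_hasProjectiveDimensionLT hd k (ModuleCat.of R (TwistedDual τ M))
    (TwistedDual.hasInjectiveDimensionLT hτ hτ' k M hM)
  have h1 := TwistedDual.hasInjectiveDimensionLT hτ' hτ l (ModuleCat.of R (TwistedDual τ M)) hl
  obtain ⟨m, hm⟩ := exists_hasProjectiveDimensionLT hd l _ h1
  exact ⟨l + m, hasProjectiveDimensionLT_of_ge _ (m + 1) _ (by lia),
    hasInjectiveDimensionLT_of_ge _ (l + 1) _ (by lia)⟩

theorem DoubleDual.exists_hasProjectiveDimensionLT_cosyzygy {d : ℕ}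
    (hd : ∀ I : ModuleCat.{u} R, Module.Injective R I → HasProjectiveDimensionLT I d)
    (hτ : ∀ r, (τ (τ' r).unop).unop = r) (hτ' : ∀ r, (τ' (τ r).unop).unop = r)
    (X : ModuleCat.{u} R) {k : ℕ} (hX : HasProjectiveDimensionLT X (k + 1)) (i : ℕ) :
    ∃ m, HasProjectiveDimensionLT (DoubleDual.cosyzygy hτ X i) (m + 1) := by
  induction i with
  | zero => exact ⟨k, hX⟩
  | succ i ih =>
    obtain ⟨l, hl⟩ := ih
    obtain ⟨m, hm, -⟩ := DoubleDual.exists_dimensionLT hd hτ hτ' _ hl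
    have h : IsShortExact (DoubleDual.incl hτ X i) (DoubleDual.proj hτ X (i + 1)) :=
      ⟨DoubleDual.incl_injective hτ X i, DoubleDual.exact_incl_proj hτ X i,
        DoubleDual.proj_surjective hτ X (i + 1)⟩
    exact ⟨l + m + 1, h.hasProjectiveDimensionLT_right
      (hasProjectiveDimensionLT_of_ge _ (l + 1) _ (by lia))
      (hasProjectiveDimensionLT_of_ge (ModuleCat.of R _) (m + 1) _ (by lia))⟩

end ShortExact

/-! ### Syzygies and their embeddings in free modules -/

section Syzygy

variable {R : Type u} [Ring R]

/-- `K` is an `n`-th syzygy of some module. -/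
def IsSyzygy : ℕ → ModuleCat.{u} R → Prop
  | 0, _ => True
  | n + 1, K => ∃ (F L : ModuleCat.{u} R) (i : K →ₗ[R] F) (p : F →ₗ[R] L),
      Module.Projective R F ∧ IsShortExact i p ∧ IsSyzygy n L

theorem IsShortExact.prod {A B C : Type u} [AddCommGroup A] [Module R A] [AddCommGroup B]
    [Module R B] [AddCommGroup C] [Module R C] {i : A →ₗ[R] B} {p : B →ₗ[R] C}
    (h : IsShortExact i p) (G : Type u) [AddCommGroup G] [Module R G] :
    IsShortExact (i.prodMap (LinearMap.id : G →ₗ[R] G)) (p ∘ₗ LinearMap.fst R B G) where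
  injective := by
    rw [LinearMap.coe_prodMap]
    exact h.injective.prodMap Function.injective_id
  exact := by
    rintro ⟨b, g⟩
    constructor
    · intro hb
      obtain ⟨a, rfl⟩ := (h.exact b).1 hb
      exact ⟨(a, g), rfl⟩
    · rintro ⟨⟨a, g'⟩, h'⟩
      obtain ⟨rfl, rfl⟩ := Prod.mk.inj h'
      exact h.exact.apply_apply_eq_zero a
  surjective := h.surjective.comp Prod.fst_surjective

theorem IsShortExact.prod_right {A B C : Type u} [AddCommGroup A] [Module R A] [AddCommGroup B]
    [Module R B] [AddCommGroup C] [Module R C] {i : A →ₗ[R] B} {p : B →ₗ[R] C}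
    (h : IsShortExact i p) (G : Type u) [AddCommGroup G] [Module R G] :
    IsShortExact (LinearMap.inl R B G ∘ₗ i) (p.prodMap (LinearMap.id : G →ₗ[R] G)) where
  injective := LinearMap.inl_injective.comp h.injective
  exact := by
    rintro ⟨b, g⟩
    constructor
    · intro hb
      obtain ⟨h1, h2⟩ := Prod.mk.inj hb
      obtain ⟨a, rfl⟩ := (h.exact b).1 h1
      exact ⟨a, Prod.ext rfl h2.symm⟩
    · rintro ⟨a, h'⟩
      obtain ⟨rfl, rfl⟩ := Prod.mk.inj h'
      exact Prod.ext (h.exact.apply_apply_eq_zero a) rfl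
  surjective := by
    rw [LinearMap.coe_prodMap]
    exact h.surjective.prodMap Function.surjective_id

theorem IsSyzygy.prod {n : ℕ} {K : ModuleCat.{u} R} (h : IsSyzygy n K) (G : Type u)
    [AddCommGroup G] [Module R G] [Module.Projective R G] :
    IsSyzygy n (ModuleCat.of R (K × G)) := by
  cases n with
  | zero => trivial
  | succ n =>
    obtain ⟨F, L, i, p, hF, hip, hL⟩ := h
    exact ⟨ModuleCat.of R (F × G), L, _, _,
      inferInstanceAs (Module.Projective R (F × G)), hip.prod G, hL⟩

/-- The horseshoe lemma: a syzygy of a short exact sequence. -/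
theorem IsShortExact.horseshoe {K F L B L' F' : Type u} [AddCommGroup K] [Module R K]
    [AddCommGroup F] [Module R F] [AddCommGroup L] [Module R L] [AddCommGroup B] [Module R B]
    [AddCommGroup L'] [Module R L'] [AddCommGroup F'] [Module R F'] [Module.Projective R F']
    {i : K →ₗ[R] F} {p : F →ₗ[R] L} (h : IsShortExact i p)
    {a : L →ₗ[R] B} {b : B →ₗ[R] L'} (hab : IsShortExact a b)
    {p' : F' →ₗ[R] L'} (hp' : Function.Surjective p') :
    ∃ (φ : (F × F') →ₗ[R] B) (j : K →ₗ[R] LinearMap.ker φ)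
      (q : LinearMap.ker φ →ₗ[R] LinearMap.ker p'),
      Function.Surjective φ ∧ IsShortExact j q := by
  obtain ⟨l, hl⟩ := Module.projective_lifting_property b p' hab.surjective
  have hl' : ∀ y, b (l y) = p' y := DFunLike.congr_fun hl
  let φ : (F × F') →ₗ[R] B := (a ∘ₗ p).coprod l
  have hφ : ∀ x y, φ (x, y) = a (p x) + l y := fun x y ↦ by simp [φ]
  have hip : ∀ x, p (i x) = 0 := h.exact.apply_apply_eq_zero
  have hba : ∀ x, b (a x) = 0 := hab.exact.apply_apply_eq_zero
  have hbφ : ∀ z, b (φ z) = p' z.2 := fun z ↦ by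
    rw [← hl', ← Prod.mk.eta (p := z), hφ, map_add, hba, zero_add]
  refine ⟨φ, (LinearMap.inl R F F' ∘ₗ i).codRestrict _ fun x ↦ ?_,
    (LinearMap.snd R F F' ∘ₗ (LinearMap.ker φ).subtype).codRestrict _ fun z ↦ ?_, ?_, ?_, ?_, ?_⟩
  · simp [hφ, hip]
  · rw [LinearMap.mem_ker, LinearMap.comp_apply, LinearMap.snd_apply, ← hbφ]
    exact (congrArg b z.2).trans (map_zero b)
  · intro y
    obtain ⟨y', hy'⟩ := hp' (b y)
    obtain ⟨c, hc⟩ := (hab.exact (y - l y')).1 (by rw [map_sub, hl', hy', sub_self])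
    obtain ⟨x, rfl⟩ := h.surjective c
    exact ⟨(x, y'), by rw [hφ, hc, sub_add_cancel]⟩
  · intro x y hxy
    exact h.injective (congrArg (fun z ↦ z.1.1) hxy)
  · rintro ⟨⟨x, y⟩, hxy⟩
    constructor
    · intro hy
      obtain rfl : y = 0 := congrArg Subtype.val hy
      rw [LinearMap.mem_ker, hφ, map_zero, add_zero] at hxy
      obtain ⟨k, rfl⟩ := (h.exact x).1 (hab.injective (hxy.trans (map_zero a).symm))
      exact ⟨k, rfl⟩
    · rintro ⟨k, hk⟩
      rw [← hk]
      rfl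
  · rintro ⟨y, hy⟩
    obtain ⟨c, hc⟩ := (hab.exact (l y)).1 ((hl' y).trans hy)
    obtain ⟨x, rfl⟩ := h.surjective c
    exact ⟨⟨(-x, y), by simp [hφ, hc]⟩, rfl⟩

/-- Starting from an embedding in an injective, each horseshoe step replaces the middle term by a
syzygy of it, lowering its projective dimension by one. At `j = 0` the middle term is projective. -/
theorem IsSyzygy.exists_embedding {n : ℕ}
    (hn : ∀ I : ModuleCat.{u} R, Module.Injective R I → HasProjectiveDimensionLT I (n + 1))
    {k j : ℕ} (hkj : k + j = n) {K : ModuleCat.{u} R} (hK : IsSyzygy k K) :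
    ∃ (B K' : ModuleCat.{u} R) (i : K →ₗ[R] B) (p : B →ₗ[R] K'),
      IsShortExact i p ∧ HasProjectiveDimensionLT B (j + 1) ∧ IsSyzygy k K' := by
  induction k generalizing K j with
  | zero =>
    obtain ⟨I, C, i, p, hI, h⟩ := IsShortExact.exists_injective K
    obtain rfl : j = n := by lia
    exact ⟨I, C, i, p, h, hn I hI, trivial⟩
  | succ k ih =>
    obtain ⟨F, L, i, p, hF, hip, hL⟩ := hK
    obtain ⟨B, L', a, b, hab, hB, hL'⟩ := ih (j := j + 1) (by lia) hL
    obtain ⟨K', i', p', h'⟩ := IsShortExact.exists_free L'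
    obtain ⟨φ, s, q, hφ, hsq⟩ := hip.horseshoe hab h'.surjective
    refine ⟨ModuleCat.of R (LinearMap.ker φ), ModuleCat.of R (LinearMap.ker p'), s, q, hsq, ?_,
      ModuleCat.of R (L' →₀ R), L', _, p', inferInstanceAs (Module.Projective R (L' →₀ R)),
      IsShortExact.ker_subtype h'.surjective, hL'⟩
    have : Module.Projective R (ModuleCat.of R (F × (L' →₀ R))) :=
      inferInstanceAs (Module.Projective R (F × (L' →₀ R)))
    exact (IsShortExact.ker_subtype hφ).hasProjectiveDimensionLT_left (A := ModuleCat.of R _)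
      (B := ModuleCat.of R (F × (L' →₀ R))) (hasProjectiveDimensionLT_succ_of_projective _ j) hB

/-- The Eilenberg swindle. -/
theorem nonempty_prod_finsupp_equiv_of_split {P F : Type u} [AddCommGroup P] [Module R P]
    [AddCommGroup F] [Module R F] (s : P →ₗ[R] F) (π : F →ₗ[R] P) (hπ : ∀ x, π (s x) = x) :
    Nonempty ((P × (ℕ →₀ F)) ≃ₗ[R] (ℕ →₀ F)) := by
  let ε : F →ₗ[R] F := s ∘ₗ π
  have hε : ∀ x, ε (ε x) = ε x := fun x ↦ congrArg s (hπ (π x))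
  have hεs : ∀ x, ε (s x) = s x := fun x ↦ congrArg s (hπ x)
  have hπε : ∀ x, π (ε x) = π x := fun x ↦ hπ (π x)
  let shift : (ℕ →₀ F) →ₗ[R] (ℕ →₀ F) := Finsupp.lmapDomain F R Nat.succ
  let unshift : (ℕ →₀ F) →ₗ[R] (ℕ →₀ F) :=
    Finsupp.lcomapDomain Nat.succ Nat.succ_injective
  have hshift0 : ∀ f, shift f 0 = 0 := fun f ↦
    Finsupp.mapDomain_of_notMem_range _ _ (by simp)
  have hshift : ∀ f i, shift f (i + 1) = f i := fun f i ↦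
    Finsupp.mapDomain_apply Nat.succ_injective f i
  have hunshift : ∀ f i, unshift f i = f (i + 1) := fun f i ↦ rfl
  let E : (ℕ →₀ F) →ₗ[R] (ℕ →₀ F) := Finsupp.mapRange.linearMap ε
  have hE : ∀ f i, E f i = ε (f i) := fun f i ↦ by simp [E]
  -- The image of `ε` is a copy of `P`: `u` moves these copies up one place, inserts the extra `P`
  -- at place 0 and fixes the complementary parts.
  let u : (P × (ℕ →₀ F)) →ₗ[R] (ℕ →₀ F) :=
    ((Finsupp.lsingle 0 : F →ₗ[R] (ℕ →₀ F)) ∘ₗ s).coprod (shift ∘ₗ E + (LinearMap.id - E))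
  let v : (ℕ →₀ F) →ₗ[R] (P × (ℕ →₀ F)) :=
    (π ∘ₗ (Finsupp.lapply 0 : (ℕ →₀ F) →ₗ[R] F)).prod (unshift ∘ₗ E + (LinearMap.id - E))
  have hu0 : ∀ x f, u (x, f) 0 = s x + (f 0 - ε (f 0)) := fun x f ↦ by
    simp [u, hshift0, hE]
  have hu : ∀ x f i, u (x, f) (i + 1) = ε (f i) + (f (i + 1) - ε (f (i + 1))) := fun x f i ↦ by
    simp [u, hshift, hE]
  have hv1 : ∀ f, (v f).1 = π (f 0) := fun f ↦ rfl
  have hv2 : ∀ f i, (v f).2 i = ε (f (i + 1)) + (f i - ε (f i)) := fun f i ↦ by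
    simp [v, hunshift, hE]
  exact
    ⟨{ u with
      invFun := v
      left_inv := by
        rintro ⟨x, f⟩
        refine Prod.ext ?_ (Finsupp.ext fun i ↦ ?_)
        · change (v (u (x, f))).1 = x
          simp [hv1, hu0, hπ, hπε]
        · change (v (u (x, f))).2 i = f i
          rw [hv2, hu]
          cases i <;> simp [hu0, hu, hε, hεs]
      right_inv := by
        intro f
        refine Finsupp.ext fun i ↦ ?_
        change u ((v f).1, (v f).2) i = f i
        cases i with
        | zero =>
          rw [hu0, hv2, hv1]
          simp only [map_add, map_sub, hε]
          change ε (f 0) + _ = _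
          abel
        | succ i =>
          rw [hu, hv2, hv2]
          simp only [map_add, map_sub, hε]
          abel }⟩

theorem Module.Projective.exists_prod_equiv_finsupp (P : Type u) [AddCommGroup P] [Module R P]
    [Module.Projective R P] :
    ∃ β γ : Type u, Nonempty ((P × (γ →₀ R)) ≃ₗ[R] (β →₀ R)) := by
  obtain ⟨s, hs⟩ := Module.projective_lifting_property
    (Finsupp.linearCombination R (id : P → P)) LinearMap.id
    (Finsupp.linearCombination_id_surjective R P)
  obtain ⟨e⟩ := nonempty_prod_finsupp_equiv_of_split s
    (Finsupp.linearCombination R id) (DFunLike.congr_fun hs)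
  let c : (ℕ →₀ P →₀ R) ≃ₗ[R] (ℕ × P →₀ R) := (Finsupp.curryLinearEquiv R).symm
  exact ⟨ℕ × P, ℕ × P, ⟨(LinearEquiv.refl R P).prodCongr c.symm ≪≫ₗ e ≪≫ₗ c⟩⟩

theorem IsSyzygy.exists_embedding_free {n : ℕ}
    (hn : ∀ I : ModuleCat.{u} R, Module.Injective R I → HasProjectiveDimensionLT I (n + 1))
    {K : ModuleCat.{u} R} (hK : IsSyzygy n K) :
    ∃ (β : Type u) (K' : ModuleCat.{u} R) (i : K →ₗ[R] (β →₀ R)) (p : (β →₀ R) →ₗ[R] K'),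
      IsShortExact i p ∧ IsSyzygy n K' := by
  obtain ⟨B, K', i, p, h, hB, hK'⟩ := hK.exists_embedding hn (add_zero n)
  have := projective_of_hasProjectiveDimensionLT_one B hB
  obtain ⟨β, γ, ⟨e⟩⟩ := Module.Projective.exists_prod_equiv_finsupp (R := R) B
  have h2 := h.prod_right (γ →₀ R)
  refine ⟨β, ModuleCat.of R (K' × (γ →₀ R)), e ∘ₗ LinearMap.inl R B (γ →₀ R) ∘ₗ i,
    p.prodMap LinearMap.id ∘ₗ e.symm, ⟨?_, ?_, ?_⟩, hK'.prod _⟩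
  · exact e.injective.comp h2.injective
  · intro x
    rw [LinearMap.comp_apply, LinearEquiv.coe_coe, h2.exact]
    constructor
    · rintro ⟨y, hy⟩
      exact ⟨y, by rw [LinearMap.comp_apply, LinearEquiv.coe_coe, hy, e.apply_symm_apply]⟩
    · rintro ⟨y, rfl⟩
      exact ⟨y, by simp⟩
  · exact h2.surjective.comp e.symm.surjective

/-- This is Ext¹(L, X) = 0: the cosyzygy of `X` has smaller injective dimension, and `L` is a syzygy
of another `n`-th syzygy. -/
theorem IsSyzygy.exists_extension_of_hasInjectiveDimensionLT {n : ℕ}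
    (hn : ∀ I : ModuleCat.{u} R, Module.Injective R I → HasProjectiveDimensionLT I (n + 1))
    (m : ℕ) (X : ModuleCat.{u} R) (hX : HasInjectiveDimensionLT X (m + 1))
    {K E : Type u} [AddCommGroup K] [Module R K] [AddCommGroup E] [Module R E]
    {L : ModuleCat.{u} R} {i : K →ₗ[R] E} {p : E →ₗ[R] L} (h : IsShortExact i p)
    (hL : IsSyzygy n L) (φ : K →ₗ[R] X) : ∃ ψ : E →ₗ[R] X, ∀ x, ψ (i x) = φ x := by
  induction m generalizing X K E L with
  | zero => exact (injective_of_hasInjectiveDimensionLT_one X hX).out i h.injective φ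
  | succ m ih =>
    obtain ⟨I, C, a, b, hI, hab⟩ := IsShortExact.exists_injective X
    obtain ⟨ψ, hψ⟩ := hI.out i h.injective (a ∘ₗ φ)
    have hba : ∀ x, b (a x) = 0 := hab.exact.apply_apply_eq_zero
    obtain ⟨ψ', hψ'⟩ := h.exists_desc (b ∘ₗ ψ) (fun x ↦ by simp [hψ, hba])
    obtain ⟨β, L', i', p', h', hL'⟩ := hL.exists_embedding_free hn
    obtain ⟨θ, hθ⟩ := ih C (hab.hasInjectiveDimensionLT_right
      (hasInjectiveDimensionLT_succ_of_injective I m) hX) h' hL' ψ'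
    obtain ⟨θ', hθ'⟩ := Module.projective_lifting_property b θ hab.surjective
    have hθ'' : ∀ x, b (θ' x) = θ x := DFunLike.congr_fun hθ'
    -- The extension into `I` is corrected by a map that factors through `p`, hence vanishes on `K`,
    -- so that it lands in `X`.
    obtain ⟨g, hg⟩ := hab.exists_lift (ψ - θ' ∘ₗ i' ∘ₗ p) (fun x ↦ by
      simp [hθ'', hθ, hψ'])
    refine ⟨g, fun x ↦ hab.injective ?_⟩
    simp [hg, hψ, h.exact.apply_apply_eq_zero x]

end Syzygy

/-! ### Vanishing of Ext from syzygies into modules of finite projective dimension -/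

section Extension

variable {R : Type u} [Ring R] {n : ℕ} {τ τ' : R →+* Rᵐᵒᵖ}

/-- A short exact sequence `0 → K → R^(β) → L → 0` with `L` an `n`-th syzygy. -/
structure FreeEmbedding (R : Type u) [Ring R] (n : ℕ) where
  β : Type u
  K : ModuleCat.{u} R
  L : ModuleCat.{u} R
  i : K →ₗ[R] (β →₀ R)
  p : (β →₀ R) →ₗ[R] L
  isShortExact : IsShortExact i p
  isSyzygy : IsSyzygy n L

theorem FreeEmbedding.exists_next
    (hn : ∀ I : ModuleCat.{u} R, Module.Injective R I → HasProjectiveDimensionLT I (n + 1))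
    (S : FreeEmbedding R n) : ∃ (β : Type u) (L : ModuleCat.{u} R) (i : S.L →ₗ[R] (β →₀ R))
      (p : (β →₀ R) →ₗ[R] L), IsShortExact i p ∧ IsSyzygy n L :=
  S.isSyzygy.exists_embedding_free hn

/-- A free embedding of the cokernel of a free embedding. -/
noncomputable def FreeEmbedding.next
    (hn : ∀ I : ModuleCat.{u} R, Module.Injective R I → HasProjectiveDimensionLT I (n + 1))
    (S : FreeEmbedding R n) : FreeEmbedding R n where
  β := (S.exists_next hn).choose
  K := S.L
  L := (S.exists_next hn).choose_spec.choose
  i := (S.exists_next hn).choose_spec.choose_spec.choose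
  p := (S.exists_next hn).choose_spec.choose_spec.choose_spec.choose
  isShortExact := (S.exists_next hn).choose_spec.choose_spec.choose_spec.choose_spec.1
  isSyzygy := (S.exists_next hn).choose_spec.choose_spec.choose_spec.choose_spec.2

/-- The sequence of free embeddings that forms a free coresolution. -/
noncomputable def FreeEmbedding.seq
    (hn : ∀ I : ModuleCat.{u} R, Module.Injective R I → HasProjectiveDimensionLT I (n + 1))
    (S : FreeEmbedding R n) : ℕ → FreeEmbedding R n
  | 0 => S
  | j + 1 => (FreeEmbedding.seq hn S j).next hn

theorem FreeEmbedding.exists_extension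
    (hn : ∀ I : ModuleCat.{u} R, Module.Injective R I → HasProjectiveDimensionLT I (n + 1))
    (hτ : ∀ r, (τ (τ' r).unop).unop = r) (hτ' : ∀ r, (τ' (τ r).unop).unop = r)
    (S : FreeEmbedding R n) (X : ModuleCat.{u} R) {k : ℕ} (hX : HasProjectiveDimensionLT X (k + 1))
    (φ : S.K →ₗ[R] X) : ∃ ψ : (S.β →₀ R) →ₗ[R] X, ∀ x, ψ (S.i x) = φ x := by
  let st := FreeEmbedding.seq hn S
  let C := DoubleDual.cosyzygy hτ X
  let Y := DoubleDual.term hτ X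
  let incl := DoubleDual.incl hτ X
  let proj := DoubleDual.proj hτ X
  have hinj : ∀ j, Function.Injective (incl j) := DoubleDual.incl_injective hτ X
  have hpi : ∀ j x, proj (j + 1) (incl j x) = 0 := fun j x ↦
    (DoubleDual.exact_incl_proj hτ X j).apply_apply_eq_zero x
  -- The double dual terms have finite injective dimension, so the map on kernels extends to the
  -- free module and induces a map of cokernels.
  have step : ∀ j (φ : (st j).K →ₗ[R] C j), ∃ (f : ((st j).β →₀ R) →ₗ[R] Y (j + 1))
      (φ' : (st j).L →ₗ[R] C (j + 1)), (∀ x, f ((st j).i x) = incl j (φ x)) ∧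
      ∀ x, φ' ((st j).p x) = proj (j + 1) (f x) := by
    intro j φ
    obtain ⟨l, hl⟩ := DoubleDual.exists_hasProjectiveDimensionLT_cosyzygy hn hτ hτ' X hX j
    obtain ⟨m, -, hm⟩ := DoubleDual.exists_dimensionLT hn hτ hτ' _ hl
    obtain ⟨f, hf⟩ := IsSyzygy.exists_extension_of_hasInjectiveDimensionLT hn m (Y (j + 1)) hm
      (st j).isShortExact (st j).isSyzygy (incl j ∘ₗ φ)
    obtain ⟨φ', hφ'⟩ := (st j).isShortExact.exists_desc (proj (j + 1) ∘ₗ f)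
      (fun x ↦ by rw [LinearMap.comp_apply, hf, LinearMap.comp_apply, hpi])
    exact ⟨f, φ', hf, hφ'⟩
  choose f φ' hf hφ' using step
  let Φ : ∀ j, (st j).K →ₗ[R] C j := fun j ↦ Nat.rec φ (fun j ψ ↦ φ' j ψ) j
  let d : ∀ j, ((st j).β →₀ R) →ₗ[R] ((st (j + 1)).β →₀ R) := fun j ↦
    (st (j + 1)).i ∘ₗ (st j).p
  have hpi' : ∀ j x, (st j).p ((st j).i x) = 0 := fun j ↦
    (st j).isShortExact.exact.apply_apply_eq_zero
  obtain ⟨s, hs⟩ := (DoubleDual.isPureExact hτ X).exists_nullHomotopy (d := d)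
    (f := fun j ↦ f j (Φ j))
    (fun j x ↦ (congrArg (incl (j + 1)) (hpi j (proj j x))).trans (map_zero _))
    (fun j x ↦ (congrArg (st (j + 1 + 1)).i (hpi' (j + 1) ((st j).p x))).trans (map_zero _))
    (fun j x ↦ (hf (j + 1) (Φ (j + 1)) ((st j).p x)).trans
      (congrArg (incl (j + 1)) (hφ' j (Φ j) x)))
  refine ⟨s 0, fun x ↦ hinj 0 ?_⟩
  -- On the image of `S.K` the differential vanishes, so the homotopy identity reduces to `s 0`
  -- followed by the inclusion of `X`.
  have h1 := hs 0 (S.i x)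
  have h2 : d 0 (S.i x) = 0 :=
    (congrArg (st 1).i (hpi' 0 x)).trans (map_zero _)
  rw [h2, map_zero, add_zero] at h1
  exact h1.symm.trans (hf 0 φ x)

open Abelian in
theorem IsSyzygy.ext_eq_zero
    (hn : ∀ I : ModuleCat.{u} R, Module.Injective R I → HasProjectiveDimensionLT I (n + 1))
    (hτ : ∀ r, (τ (τ' r).unop).unop = r) (hτ' : ∀ r, (τ' (τ r).unop).unop = r)
    (X : ModuleCat.{u} R) {l : ℕ} (hX : HasProjectiveDimensionLT X (l + 1))
    {k j : ℕ} (hkj : k + j = n) (L : ModuleCat.{u} R) (hL : IsSyzygy j L)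
    (x : Ext L X (k + 1)) : x = 0 := by
  induction k generalizing j L with
  | zero =>
    obtain rfl : j = n := by lia
    obtain ⟨K, i, p, h⟩ := IsShortExact.exists_free L
    have hF : HasProjectiveDimensionLT (ModuleCat.of R (L →₀ R)) 1 :=
      hasProjectiveDimensionLT_succ_of_projective _ 0
    obtain ⟨y, rfl⟩ := Ext.contravariant_sequence_exact₃ h.shortExact X x
      (Ext.eq_zero_of_hasProjectiveDimensionLT _ 1 (by lia)) (add_comm 1 0)
    obtain ⟨g, rfl⟩ := Ext.homEquiv₀.symm.surjective y
    obtain ⟨ψ, hψ⟩ := FreeEmbedding.exists_extension hn hτ hτ' ⟨L, K, L, i, p, h, hL⟩ X hX g.hom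
    have hg : g = ModuleCat.ofHom i ≫ ModuleCat.ofHom ψ := by
      ext x
      exact (hψ x).symm
    rw [Ext.homEquiv₀_symm_apply, hg, ← Ext.mk₀_comp_mk₀]
    -- The class is the pushout of the extension along a map that extends to the middle term, hence
    -- zero.
    exact h.shortExact.extClass_comp_assoc _
  | succ k ih =>
    obtain ⟨K, i, p, h⟩ := IsShortExact.exists_free L
    have hF : HasProjectiveDimensionLT (ModuleCat.of R (L →₀ R)) 1 :=
      hasProjectiveDimensionLT_succ_of_projective _ 0
    obtain ⟨y, rfl⟩ := Ext.contravariant_sequence_exact₃ h.shortExact X x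
      (Ext.eq_zero_of_hasProjectiveDimensionLT _ 1 (by lia)) (add_comm 1 (k + 1))
    have hy : y = 0 := ih (j := j + 1) (by lia) K
      ⟨ModuleCat.of R (L →₀ R), L, i, p, inferInstanceAs (Module.Projective R (L →₀ R)), h, hL⟩ y
    rw [hy, Ext.comp_zero]

theorem hasInjectiveDimensionLT_of_injective_hasProjectiveDimensionLT {d : ℕ}
    (hd : ∀ I : ModuleCat.{u} R, Module.Injective R I → HasProjectiveDimensionLT I d)
    (hτ : ∀ r, (τ (τ' r).unop).unop = r) (hτ' : ∀ r, (τ' (τ r).unop).unop = r)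
    (P : ModuleCat.{u} R) [Module.Projective R P] : HasInjectiveDimensionLT P d := by
  cases d with
  | zero =>
    -- Here all injectives vanish, hence so does every module.
    obtain ⟨I, C, i, p, hI, h⟩ := IsShortExact.exists_injective P
    have hI0 := (hasProjectiveDimensionLT_zero_iff_isZero _).1 (hd I hI)
    have : Subsingleton I := ModuleCat.subsingleton_of_isZero hI0
    have : Subsingleton P := h.injective.subsingleton
    exact (hasInjectiveDimensionLT_zero_iff_isZero _).2 (ModuleCat.isZero_of_subsingleton P)
  | succ n =>
    refine hasInjectiveDimensionLT_of_enoughProjectives P _ fun L ↦ ⟨fun x y ↦ ?_⟩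
    have hP := hasProjectiveDimensionLT_succ_of_projective P 0
    rw [IsSyzygy.ext_eq_zero hd hτ hτ' P hP (add_zero n) L trivial x,
      IsSyzygy.ext_eq_zero hd hτ hτ' P hP (add_zero n) L trivial y]

end Extension

/-! ### The reverse inequality -/

section Converse

variable {R : Type u} [Ring R]

-- In degree `e + c`, Ext out of `M` vanishes on free modules. If the next degree vanishes too,
-- covering `Z` by a free module shows that it vanishes on every `Z`, so the bound descends to `e`.
open Abelian in
theorem hasProjectiveDimensionLT_of_projective_hasInjectiveDimensionLT {e d : ℕ}
    (he : ∀ P : ModuleCat.{u} R, Module.Projective R P → HasInjectiveDimensionLT P e)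
    (M : ModuleCat.{u} R) (hM : HasProjectiveDimensionLT M d) : HasProjectiveDimensionLT M e := by
  obtain hde | hed := le_total d e
  · exact hasProjectiveDimensionLT_of_ge M d e hde
  obtain ⟨c, rfl⟩ := Nat.exists_eq_add_of_le hed
  clear hed
  induction c with
  | zero => exact hM
  | succ c ih =>
    refine ih (hasProjectiveDimensionLT_of_enoughInjectives M _ fun Z ↦ ⟨fun x y ↦ ?_⟩)
    have key : ∀ x : Ext M Z (e + c), x = 0 := by
      intro x
      obtain ⟨K, i, p, h⟩ := IsShortExact.exists_free Z
      have hF := he (ModuleCat.of R (Z →₀ R)) (inferInstanceAs (Module.Projective R (Z →₀ R)))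
      obtain ⟨y, rfl⟩ := Ext.covariant_sequence_exact₃ M h.shortExact x rfl
        (Ext.eq_zero_of_hasProjectiveDimensionLT _ (e + (c + 1)) (by lia))
      have hy : y = 0 := @Ext.eq_zero_of_hasInjectiveDimensionLT _ _ _ _ (ModuleCat.of R (Z →₀ R))
        M _ y e hF (by lia)
      rw [hy, Ext.zero_comp]
    rw [key x, key y]

end Converse

/-! ### Comparison of the suprema and group algebras -/

/-- A strict bound passes to the supremum because `< 0` means `= ⊥` and `< d + 1` means `≤ d`. -/
theorem iSup_lt_natCast {ι : Type*} {p : ι → Prop} (f : ι → WithBot ℕ∞) (d : ℕ) :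
    ⨆ (i) (_ : p i), f i < d ↔ ∀ i, p i → f i < d := by
  constructor
  · exact fun h i hi ↦ (le_iSup₂ (f := fun i (_ : p i) ↦ f i) i hi).trans_lt h
  · intro h
    cases d with
    | zero =>
      have : ⨆ (i) (_ : p i), f i ≤ ⊥ := iSup₂_le fun i hi ↦ by
        have := h i hi
        simpa [WithBot.lt_zero_iff_eq_bot] using this
      exact this.trans_lt (by simp)
    | succ d =>
      have : ⨆ (i) (_ : p i), f i ≤ d := iSup₂_le fun i hi ↦ by
        have := h i hi
        rwa [Nat.cast_succ, ENat.WithBot.lt_add_one_iff] at this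
      rwa [Nat.cast_succ, ENat.WithBot.lt_add_one_iff]

theorem WithBot.le_of_forall_lt_natCast {a b : WithBot ℕ∞} (h : ∀ d : ℕ, b < d → a < d) :
    a ≤ b := by
  induction b with
  | bot =>
    have := h 0 (by simp)
    simp [WithBot.lt_zero_iff_eq_bot] at this
    simp [this]
  | coe b =>
    induction b with
    | top => exact le_top
    | coe b =>
      have := h (b + 1) (by exact_mod_cast Nat.lt_succ_self b)
      rwa [Nat.cast_succ, ENat.WithBot.lt_add_one_iff] at this

theorem silp_lt_iff (R : Type u) [Ring R] (d : ℕ) :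
    silp R < d ↔ ∀ P : ModuleCat.{u} R, Module.Projective R P → HasInjectiveDimensionLT P d := by
  simp only [silp, iSup_lt_natCast, injectiveDimension_lt_iff]

theorem spli_lt_iff (R : Type u) [Ring R] (d : ℕ) :
    spli R < d ↔ ∀ I : ModuleCat.{u} R, Module.Injective R I → HasProjectiveDimensionLT I d := by
  simp only [spli, iSup_lt_natCast, projectiveDimension_lt_iff]

theorem silp_le_spli {R : Type u} [Ring R] (σ : R ≃+* Rᵐᵒᵖ) : silp R ≤ spli R := by
  refine WithBot.le_of_forall_lt_natCast fun d hd ↦ ?_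
  rw [spli_lt_iff] at hd
  rw [silp_lt_iff]
  intro P _
  -- The inverse anti-automorphism; `σ` need not be an involution, so the second dual is twisted by
  -- its inverse.
  let τ' : R →+* Rᵐᵒᵖ :=
    { toFun := fun r ↦ MulOpposite.op (σ.symm (MulOpposite.op r))
      map_one' := by simp
      map_mul' := by simp
      map_zero' := by simp
      map_add' := by simp }
  exact hasInjectiveDimensionLT_of_injective_hasProjectiveDimensionLT (τ := σ.toRingHom)
    (τ' := τ') hd (fun r ↦ by simp [τ']) (fun r ↦ by simp [τ']) P

theorem spli_le_silp {R : Type u} [Ring R] (h : spli R < ⊤) : spli R ≤ silp R := by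
  obtain ⟨d, hd⟩ : ∃ d : ℕ, spli R < d := by
    generalize spli R = a at h
    induction a with
    | bot => exact ⟨0, by simp⟩
    | coe a =>
      induction a with
      | top => simp at h
      | coe a => exact ⟨a + 1, by exact_mod_cast Nat.lt_succ_self a⟩
  rw [spli_lt_iff] at hd
  refine WithBot.le_of_forall_lt_natCast fun e he ↦ ?_
  rw [silp_lt_iff] at he
  rw [spli_lt_iff]
  exact fun I hI ↦ hasProjectiveDimensionLT_of_projective_hasInjectiveDimensionLT he I (hd I hI)

theorem silp_eq_spli {R : Type u} [Ring R] (σ : R ≃+* Rᵐᵒᵖ) (h : spli R < ⊤) :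
    silp R = spli R :=
  (silp_le_spli σ).antisymm (spli_le_silp h)

/-- The anti-automorphism of a group algebra that inverts the group elements. -/
noncomputable def MonoidAlgebra.ringEquivOp (k : Type u) [CommRing k] (G : Type v) [Group G] :
    MonoidAlgebra k G ≃+* (MonoidAlgebra k G)ᵐᵒᵖ :=
  (MonoidAlgebra.mapDomainRingEquiv k (MulEquiv.inv' G)).trans <|
    (MonoidAlgebra.mapRingEquiv Gᵐᵒᵖ (RingEquiv.toOpposite k)).trans
      MonoidAlgebra.opRingEquiv.symm

theorem corollary5p4 :
    (∀ (R : Type u) [Ring R], Nonempty (R ≃+* Rᵐᵒᵖ) →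
      silp R ≤ spli R ∧ (spli R < ⊤ → silp R = spli R)) ∧
    (∀ (k : Type u) [CommRing k] (G : Type v) [Group G],
      Nonempty (MonoidAlgebra k G ≃+* (MonoidAlgebra k G)ᵐᵒᵖ) ∧
      silp (MonoidAlgebra k G) ≤ spli (MonoidAlgebra k G) ∧
      (spli (MonoidAlgebra k G) < ⊤ → silp (MonoidAlgebra k G) = spli (MonoidAlgebra k G))) :=
  ⟨fun _ _ ⟨σ⟩ ↦ ⟨silp_le_spli σ, silp_eq_spli σ⟩, fun k _ G _ ↦
    have σ := MonoidAlgebra.ringEquivOp k G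
    ⟨⟨σ⟩, silp_le_spli σ, silp_eq_spli σ⟩⟩
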